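/- Let $\mathbf t = 0110100110010110\cdots$ be the Thue--Morse word, that is, the fixed point starting with $0$ of the substitution $0\mapsto 01$, $1\mapsto 10$. An abelian square of order $n$ is a word $xy$ over $\{0,1\}$ such that $|x|=|y|=n$ and $x$, $y$ contain each letter the same number of times. Let $f(n)$ be the number of distinct abelian squares of order $n$ (hence of length $2n$) that are factors of $\mathbf t$; for $n=0$ the empty word is counted, so that $f(0)=1$. Theorem. For every integer $n\ge 0$, if $(n)_2=a_1a_2\cdots a_i$ is the base-$2$ representation of $n$, most significant digit first (the empty string for $n=0$), then $$f(n)=v\,M_{a_1}M_{a_2}\cdots M_{a_i}\,w,$$ where $v=[1,0,0,0,0,0,0,0,0,0,0]$, $w=[1,2,4,4,10,8,24,10,22,12,36]^T$, $$M_0=\begin{bmatrix}1&0&0&0&0&0&0&0&0&0&0\\ 0&0&1&0&0&0&0&0&0&0&0\\ 0&0&0&0&1&0&0&0&0&0&0\\ 0&0&0&0&0&0&1&0&0&0&0\\ 0&0&0&0&0&0&0&0&1&0&0\\ 0&0&0&0&0&0&0&0&0&0&1\\ 0&0&\frac{64}{13}&1&-\frac{171}{26}&-\frac{69}{26}&0&0&\frac{43}{26}&\frac{9}{13}&\frac{51}{26}\\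 0&0&\frac{90}{13}&-1&-\frac{275}{26}&\frac{9}{26}&0&2&\frac{69}{26}&-\frac{17}{13}&\frac{51}{26}\\ 0&0&-2&0&1&0&0&0&2&0&0\\ 0&0&\frac{68}{13}&0&-\frac{88}{13}&-\frac{33}{13}&0&0&\frac{20}{13}&\frac{12}{13}&\frac{34}{13}\\ 0&0&\frac{54}{13}&0&-\frac{89}{13}&-\frac{22}{13}&0&0&\frac{35}{13}&\frac{8}{13}&\frac{27}{13}\end{bmatrix},$$ $$M_1=\begin{bmatrix}0&1&0&0&0&0&0&0&0&0&0\\ 0&0&0&1&0&0&0&0&0&0&0\\ 0&0&0&0&0&1&0&0&0&0&0\\ 0&0&0&0&0&0&0&1&0&0&0\\ 0&0&0&0&0&0&0&0&0&1&0\\ 0&0&-\frac{8}{13}&0&-\frac{8}{13}&\frac{10}{13}&0&0&\frac{16}{13}&\frac{7}{13}&-\frac{4}{13}\\ 0&0&-\frac{87}{13}&-1&\frac{203}{26}&\frac{3}{26}&2&0&-\frac{3}{26}&\frac{16}{13}&-\frac{61}{26}\\ 0&0&-\frac{7}{13}&1&\frac{25}{26}&-\frac{93}{26}&0&0&\frac{15}{26}&\frac{37}{13}&-\frac{7}{26}\\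 0&0&\frac{20}{13}&0&-\frac{45}{13}&-\frac{12}{13}&0&0&\frac{25}{13}&\frac{28}{13}&-\frac{3}{13}\\ 0&0&-\frac{40}{13}&0&\frac{25}{13}&-\frac{2}{13}&0&0&\frac{15}{13}&\frac{22}{13}&-\frac{7}{13}\\ 0&0&-\frac{36}{13}&0&\frac{29}{13}&-\frac{20}{13}&0&0&\frac{7}{13}&\frac{38}{13}&-\frac{5}{13}\end{bmatrix}.$$ In particular, the sequence $(f(n))_{n\ge 0}$ is $2$-regular, that is, the $\mathbb Z$-module generated by the sequences $(f(2^e n+r))_{n\ge 0}$ with $e\ge 0$ and $0\le r<2^e$ is finitely generated. -/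

import Mathlib

open scoped Matrix

namespace ThueMorse

/-- The substitution `0 ↦ 01`, `1 ↦ 10` on letters. -/
def subst (a : Fin 2) : List (Fin 2) := if a = 0 then [0, 1] else [1, 0]

/-- The extension of the substitution to a morphism of finite words. -/
def morphism (u : List (Fin 2)) : List (Fin 2) := u.flatMap subst

/-- The infinite Thue-Morse word, the limit of the iterates of the morphism on the letter `0`:
its letter at position `n` is that of the `n`-th iterate, which has length `2 ^ n > n`. -/
def word (n : ℕ) : Fin 2 := (morphism^[n] [0]).getD n 0

/-- The factor of length `m` of the infinite word `t` that starts at position `i`. -/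
def factorAt (t : ℕ → Fin 2) (i m : ℕ) : List (Fin 2) :=
  (List.range m).map fun k => t (i + k)

/-- The finite word `u` is a factor of the infinite word `t`. -/
def IsFactor (t : ℕ → Fin 2) (u : List (Fin 2)) : Prop :=
  ∃ i, u = factorAt t i u.length

/-- The Parikh vector of a finite word: the number of occurrences of each letter. -/
def parikh (u : List (Fin 2)) : Fin 2 → ℕ := fun a => u.count a

/-- `u` is an abelian square of order `n`: it is `x ++ y` with `x` and `y` of the same Parikh
vector and `x` of length `n` (so `u` has length `2 * n`). For `n = 0` this is the empty word. -/
def IsAbelianSquareOfOrder (n : ℕ) (u : List (Fin 2)) : Prop :=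
  ∃ x y : List (Fin 2), u = x ++ y ∧ x.length = n ∧ parikh x = parikh y

/-- The number of distinct abelian squares of order `n` in the Thue-Morse word. -/
noncomputable def f (n : ℕ) : ℕ :=
  Set.ncard {u : List (Fin 2) | IsFactor word u ∧ IsAbelianSquareOfOrder n u}

/-- The `k`-kernel of a sequence: its subsequences `n ↦ s (k ^ e * n + r)`, `0 ≤ r < k ^ e`. -/
def kernel (k : ℕ) (s : ℕ → ℤ) : Set (ℕ → ℤ) :=
  {g | ∃ e r : ℕ, r < k ^ e ∧ g = fun n => s (k ^ e * n + r)}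

/-- An integer sequence is `k`-regular (Allouche and Shallit) if the `ℤ`-module generated by its
`k`-kernel is finitely generated. -/
def IsRegular (k : ℕ) (s : ℕ → ℤ) : Prop :=
  (Submodule.span ℤ (kernel k s)).FG

def M₀ : Matrix (Fin 11) (Fin 11) ℚ :=
  !![1, 0, 0, 0, 0, 0, 0, 0, 0, 0, 0;
     0, 0, 1, 0, 0, 0, 0, 0, 0, 0, 0;
     0, 0, 0, 0, 1, 0, 0, 0, 0, 0, 0;
     0, 0, 0, 0, 0, 0, 1, 0, 0, 0, 0;
     0, 0, 0, 0, 0, 0, 0, 0, 1, 0, 0;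
     0, 0, 0, 0, 0, 0, 0, 0, 0, 0, 1;
     0, 0, 64/13, 1, -171/26, -69/26, 0, 0, 43/26, 9/13, 51/26;
     0, 0, 90/13, -1, -275/26, 9/26, 0, 2, 69/26, -17/13, 51/26;
     0, 0, -2, 0, 1, 0, 0, 0, 2, 0, 0;
     0, 0, 68/13, 0, -88/13, -33/13, 0, 0, 20/13, 12/13, 34/13;
     0, 0, 54/13, 0, -89/13, -22/13, 0, 0, 35/13, 8/13, 27/13]

def M₁ : Matrix (Fin 11) (Fin 11) ℚ :=
  !![0, 1, 0, 0, 0, 0, 0, 0, 0, 0, 0;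
     0, 0, 0, 1, 0, 0, 0, 0, 0, 0, 0;
     0, 0, 0, 0, 0, 1, 0, 0, 0, 0, 0;
     0, 0, 0, 0, 0, 0, 0, 1, 0, 0, 0;
     0, 0, 0, 0, 0, 0, 0, 0, 0, 1, 0;
     0, 0, -8/13, 0, -8/13, 10/13, 0, 0, 16/13, 7/13, -4/13;
     0, 0, -87/13, -1, 203/26, 3/26, 2, 0, -3/26, 16/13, -61/26;
     0, 0, -7/13, 1, 25/26, -93/26, 0, 0, 15/26, 37/13, -7/26;
     0, 0, 20/13, 0, -45/13, -12/13, 0, 0, 25/13, 28/13, -3/13;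
     0, 0, -40/13, 0, 25/13, -2/13, 0, 0, 15/13, 22/13, -7/13;
     0, 0, -36/13, 0, 29/13, -20/13, 0, 0, 7/13, 38/13, -5/13]

/-- The matrix attached to a binary digit. -/
def M (d : ℕ) : Matrix (Fin 11) (Fin 11) ℚ := if d = 0 then M₀ else M₁

def v : Fin 11 → ℚ := ![1, 0, 0, 0, 0, 0, 0, 0, 0, 0, 0]

def w : Fin 11 → ℚ := ![1, 2, 4, 4, 10, 8, 24, 10, 22, 12, 36]

/-- The base-2 digits of `n`, most significant first (the empty list for `n = 0`). -/
def binary (n : ℕ) : List ℕ := (Nat.digits 2 n).reverse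

theorem morphism_length (u : List (Fin 2)) : (morphism u).length = 2 * u.length := by
  induction u with
  | nil => rfl
  | cons a u ih =>
    have h : (subst a).length = 2 := by fin_cases a <;> rfl
    simp only [morphism, List.flatMap_cons, List.length_append, List.length_cons] at *
    omega

theorem iterate_length (n : ℕ) : (morphism^[n] [0]).length = 2 ^ n := by
  induction n with
  | zero => rfl
  | succ n ih => rw [Function.iterate_succ_apply', morphism_length, ih, pow_succ']

theorem iterate_prefix (n : ℕ) : morphism^[n] [0] <+: morphism^[n + 1] [0] := by
  induction n with
  | zero => exact ⟨[1], rfl⟩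
  | succ n ih =>
    obtain ⟨z, hz⟩ := ih
    refine ⟨morphism z, ?_⟩
    have h : ∀ a b, morphism (a ++ b) = morphism a ++ morphism b := fun a b => by
      simp [morphism]
    rw [Function.iterate_succ_apply' _ (n + 1), ← hz, h, hz, Function.iterate_succ_apply']

theorem iterate_prefix_of_le {m n : ℕ} (h : m ≤ n) :
    morphism^[m] [0] <+: morphism^[n] [0] := by
  induction n, h using Nat.le_induction with
  | base => exact List.prefix_rfl
  | succ n _ ih => exact ih.trans (iterate_prefix n)

/-- Every iterate of the morphism on `0` is a prefix of the Thue-Morse word. -/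
theorem iterate_eq_factorAt (n : ℕ) : morphism^[n] [0] = factorAt word 0 (2 ^ n) := by
  refine List.ext_getElem (by simp [iterate_length, factorAt]) fun i h₁ h₂ => ?_
  have hi : i < (morphism^[i] [0]).length := by
    rw [iterate_length]; exact Nat.lt_two_pow_self
  simp only [factorAt, List.getElem_map, List.getElem_range, zero_add, word]
  rw [List.getD_eq_getElem _ _ hi]
  rcases le_total i n with h | h
  · exact ((iterate_prefix_of_le h).getElem hi).symm
  · exact (iterate_prefix_of_le h).getElem h₁

theorem word_zero : word 0 = 0 := rfl

theorem morphism_getElem (u : List (Fin 2)) (i : ℕ) (h : i < u.length) :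
    [(morphism u).getD (2 * i) 0, (morphism u).getD (2 * i + 1) 0] = subst u[i] := by
  induction u generalizing i with
  | nil => simp at h
  | cons a u ih =>
    have hs : morphism (a :: u) = a :: (1 - a) :: morphism u := by
      fin_cases a <;> rfl
    cases i with
    | zero => rw [hs]; fin_cases a <;> rfl
    | succ i =>
      rw [hs]
      simpa [Nat.mul_succ] using ih i (by simpa using h)

/-- The Thue-Morse word, which begins with `0`, is a fixed point of the morphism. -/
theorem word_fixed_point (n : ℕ) : [word (2 * n), word (2 * n + 1)] = subst (word n) := by
  have key : ∀ m k : ℕ, m < 2 ^ k → (morphism^[k] [0]).getD m 0 = word m := by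
    intro m k h
    rw [iterate_eq_factorAt, List.getD_eq_getElem _ _ (by simpa [factorAt] using h)]
    simp [factorAt]
  have hn : n < 2 ^ n := Nat.lt_two_pow_self
  have h := morphism_getElem (morphism^[n] [0]) n (by rwa [iterate_length])
  rw [← Function.iterate_succ_apply' morphism, key _ _ (by rw [pow_succ]; omega),
    key _ _ (by rw [pow_succ]; omega), ← List.getD_eq_getElem _ 0, key _ _ hn] at h
  exact h

end ThueMorse

namespace ThueMorse

/-! Write t for the word. The proof rests on desubstitution: t is a concatenation of blocks 01 and
10, and a factor of length at least 4 determines the parity of its positions, since otherwise t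
would contain a cube of a letter. So counting factors of length L splits into counting shorter
factors at even and at odd positions (`factorCount_split`), for any condition imposed on the
positions.

The number of ones in a prefix of t is j for length 2j and j + t_j for length 2j + 1. Hence being an
abelian square of order n at a position becomes, after one desubstitution, a condition on at most
three letters: void for even order at an even position, impossible for odd order at an even
position, and otherwise a relation between letters of the preimage (`f_two_mul`,
`f_two_mul_add_one`). The remaining counts are the subword complexity, `pairCount` and
`tripleCount`; the latter need only the offsets (n, 2n), (n+1, 2n+2), (n, 2n+1), (n+1, 2n+1), a
family closed under halving. The result is a closed system of recurrences for n ≥ 2.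

The matrices make `coords n` the n-th unit vector for n ≤ 10, so a sequence they represent has its
first eleven values as coefficient vector. By induction on binary digits each count is represented
in this way for n ≥ 2 (`IsLinear`); each induction step is a finite identity between rational
vectors. The denominators prevent reading 2-regularity off the matrices, so it is derived from the
integer recurrences: the counts, with two sequences that absorb the exceptions n = 0, 1, span a
finitely generated ℤ-module stable under n ↦ 2n and n ↦ 2n + 1. -/

/-! ### Letters and short factors of the Thue-Morse word. -/

theorem word_two_mul (n : ℕ) : word (2 * n) = word n := by
  have h := word_fixed_point n
  generalize word (2 * n) = a at *
  generalize word (2 * n + 1) = b at *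
  generalize word n = c at *
  revert a b c; decide

theorem word_two_mul_add_one (n : ℕ) : word (2 * n + 1) = word n + 1 := by
  have h := word_fixed_point n
  generalize word (2 * n) = a at *
  generalize word (2 * n + 1) = b at *
  generalize word n = c at *
  revert a b c; decide

theorem factorAt_eq_iff {t : ℕ → Fin 2} {i j m : ℕ} :
    factorAt t i m = factorAt t j m ↔ ∀ k < m, t (i + k) = t (j + k) := by
  simp [factorAt]

/-- The Thue-Morse word contains no cube of a letter. -/
theorem not_word_cube (i : ℕ) : ¬ (word i = word (i + 1) ∧ word (i + 1) = word (i + 2)) := by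
  rintro ⟨h1, h2⟩
  obtain ⟨j, rfl | rfl⟩ := Nat.even_or_odd' i
  · rw [word_two_mul, word_two_mul_add_one] at h1
    revert h1; generalize word j = a; revert a; decide
  · rw [show 2 * j + 1 + 1 = 2 * (j + 1) by ring, show 2 * j + 1 + 2 = 2 * (j + 1) + 1 by ring,
      word_two_mul, word_two_mul_add_one] at h2
    revert h2; generalize word (j + 1) = a; revert a; decide

/-- The prefix 01101001 already contains all six non-constant words of length 3. -/
theorem exists_word_triple (a b c : Fin 2) (h : ¬ (a = b ∧ b = c)) :
    ∃ i, word i = a ∧ word (i + 1) = b ∧ word (i + 2) = c := by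
  have e0 : word 0 = 0 := rfl
  have e1 : word 1 = 1 := by decide
  have e2 : word 2 = 1 := by decide
  have e3 : word 3 = 0 := by decide
  have e4 : word 4 = 1 := by rw [← e2]; exact word_two_mul 2
  have e5 : word 5 = 0 := by have := word_two_mul_add_one 2; rwa [e2] at this
  have e6 : word 6 = 0 := by rw [← e3]; exact word_two_mul 3
  have e7 : word 7 = 1 := by have := word_two_mul_add_one 3; rwa [e3] at this
  fin_cases a <;> fin_cases b <;> fin_cases c <;> first
    | exact absurd ⟨rfl, rfl⟩ h
    | exact ⟨0, e0, e1, e2⟩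
    | exact ⟨1, e1, e2, e3⟩
    | exact ⟨2, e2, e3, e4⟩
    | exact ⟨3, e3, e4, e5⟩
    | exact ⟨4, e4, e5, e6⟩
    | exact ⟨5, e5, e6, e7⟩

/-! ### Counting factors by desubstitution. -/

/-- The number of distinct factors of length `L` of the Thue-Morse word that occur at a position
satisfying `Q`. -/
noncomputable def factorCount (L : ℕ) (Q : ℕ → Prop) : ℕ :=
  ((fun i => factorAt word i L) '' {i | Q i}).ncard

theorem factorCount_congr {L L' : ℕ} {Q Q' : ℕ → Prop} (hL : L = L') (h : ∀ i, Q i ↔ Q' i) :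
    factorCount L Q = factorCount L' Q' := by
  rw [hL, show Q = Q' from funext fun i => propext (h i)]

/-- Both images are quotients of `s` by the same equivalence relation. -/
theorem ncard_image_congr {α β γ : Type*} {F : α → β} {G : α → γ} {s : Set α}
    (h : ∀ a b, F a = F b ↔ G a = G b) : (F '' s).ncard = (G '' s).ncard := by
  refine Set.ncard_congr (fun b hb => G hb.choose) ?_ ?_ ?_
  · intro b hb
    exact ⟨_, hb.choose_spec.1, rfl⟩
  · intro b c hb hc hbc
    rw [← hb.choose_spec.2, ← hc.choose_spec.2]
    exact (h _ _).2 hbc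
  · rintro _ ⟨a, ha, rfl⟩
    have hm : F a ∈ F '' s := ⟨a, ha, rfl⟩
    exact ⟨F a, hm, (h _ _).1 hm.choose_spec.2⟩

theorem finite_image_factorAt (L : ℕ) (s : Set ℕ) :
    ((fun i => factorAt word i L) '' s).Finite := by
  refine (List.finite_length_eq (Fin 2) L).subset ?_
  rintro _ ⟨i, -, rfl⟩
  simp [factorAt]

/-- A window starting at a block boundary meets ⌈L/2⌉ blocks, and the first letter of each block,
which determines the block, lies in the window. -/
theorem factorAt_two_mul_eq_iff (i j L : ℕ) :
    factorAt word (2 * i) L = factorAt word (2 * j) L ↔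
      factorAt word i ((L + 1) / 2) = factorAt word j ((L + 1) / 2) := by
  simp only [factorAt_eq_iff]
  constructor
  · intro h k hk
    have := h (2 * k) (by omega)
    rwa [← mul_add, ← mul_add, word_two_mul, word_two_mul] at this
  · intro h k hk
    obtain ⟨l, rfl | rfl⟩ := Nat.even_or_odd' k
    · rw [← mul_add, ← mul_add, word_two_mul, word_two_mul]
      exact h l (by omega)
    · rw [← add_assoc, ← add_assoc, ← mul_add, ← mul_add, word_two_mul_add_one,
        word_two_mul_add_one, h l (by omega)]

/-- The window now begins with the second letter of a block, which still determines that block;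
hence one more preimage letter when L is even. -/
theorem factorAt_two_mul_add_one_eq_iff (i j L : ℕ) (hL : 0 < L) :
    factorAt word (2 * i + 1) L = factorAt word (2 * j + 1) L ↔
      factorAt word i (L / 2 + 1) = factorAt word j (L / 2 + 1) := by
  have h1 : ∀ a b, 2 * a + 1 + 2 * b = 2 * (a + b) + 1 := fun a b => by ring
  have h2 : ∀ a b, 2 * a + 1 + (2 * b + 1) = 2 * (a + (b + 1)) := fun a b => by ring
  simp only [factorAt_eq_iff]
  constructor
  · rintro h (_ | k) hk
    · have := h (2 * 0) hL
      rwa [h1, h1, word_two_mul_add_one, word_two_mul_add_one, add_left_inj] at this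
    · have := h (2 * k + 1) (by omega)
      rwa [h2, h2, word_two_mul, word_two_mul] at this
  · intro h k hk
    obtain ⟨l, rfl | rfl⟩ := Nat.even_or_odd' k
    · rw [h1, h1, word_two_mul_add_one, word_two_mul_add_one, h l (by omega)]
    · rw [h2, h2, word_two_mul, word_two_mul, h (l + 1) (by omega)]

/-- A factor of length at least `4` does not occur at positions of both parities. -/
theorem factorAt_two_mul_ne (i j L : ℕ) (hL : 4 ≤ L) :
    factorAt word (2 * i) L ≠ factorAt word (2 * j + 1) L := by
  rw [Ne, factorAt_eq_iff]
  intro h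
  have h0 := h 0 (by omega)
  have h1 := h 1 (by omega)
  have h2 := h 2 (by omega)
  have h3 := h 3 (by omega)
  rw [add_zero, add_zero, word_two_mul, word_two_mul_add_one] at h0
  rw [show 2 * j + 1 + 1 = 2 * (j + 1) by ring, word_two_mul, word_two_mul_add_one] at h1
  rw [show 2 * j + 1 + 2 = 2 * (j + 1) + 1 by ring, show 2 * i + 2 = 2 * (i + 1) by ring,
    word_two_mul, word_two_mul_add_one] at h2
  rw [show 2 * j + 1 + 3 = 2 * (j + 2) by ring, show 2 * i + 3 = 2 * (i + 1) + 1 by ring,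
    word_two_mul, word_two_mul_add_one] at h3
  -- The four equations force the letters of t at j, j + 1, j + 2 to be equal.
  have hc := not_word_cube j
  generalize word i = a at *
  generalize word (i + 1) = b at *
  generalize word j = c at *
  generalize word (j + 1) = d at *
  generalize word (j + 2) = e at *
  revert a b c d e; decide

/-- The factors of length at least `4` are counted by desubstitution. -/
theorem factorCount_split {L : ℕ} (hL : 4 ≤ L) (Q : ℕ → Prop) :
    factorCount L Q = factorCount ((L + 1) / 2) (fun j => Q (2 * j)) +
      factorCount (L / 2 + 1) (fun j => Q (2 * j + 1)) := by
  have hu : (fun i => factorAt word i L) '' {i | Q i} =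
      (fun i => factorAt word (2 * i) L) '' {j | Q (2 * j)} ∪
      (fun i => factorAt word (2 * i + 1) L) '' {j | Q (2 * j + 1)} := by
    ext u
    constructor
    · rintro ⟨i, hi, rfl⟩
      obtain ⟨j, rfl | rfl⟩ := Nat.even_or_odd' i
      · exact Or.inl ⟨j, hi, rfl⟩
      · exact Or.inr ⟨j, hi, rfl⟩
    · rintro (⟨j, hj, rfl⟩ | ⟨j, hj, rfl⟩)
      · exact ⟨2 * j, hj, rfl⟩
      · exact ⟨2 * j + 1, hj, rfl⟩
  have hfin := finite_image_factorAt L {i | Q i}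
  rw [hu] at hfin
  rw [factorCount, hu, Set.ncard_union_eq _ (hfin.subset Set.subset_union_left)
    (hfin.subset Set.subset_union_right)]
  · congr 1
    · exact ncard_image_congr fun a b => factorAt_two_mul_eq_iff a b L
    · exact ncard_image_congr fun a b => factorAt_two_mul_add_one_eq_iff a b L (by omega)
  · rw [Set.disjoint_left]
    rintro _ ⟨i, -, rfl⟩ ⟨j, -, h⟩
    exact factorAt_two_mul_ne i j L hL h.symm

theorem factorCount_false (L : ℕ) : factorCount L (fun _ => False) = 0 := by
  simp [factorCount]

theorem factorCount_three {Q : ℕ → Prop} (q : Fin 2 → Fin 2 → Fin 2 → Prop)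
    [∀ a b c, Decidable (q a b c)] (h : ∀ i, Q i ↔ q (word i) (word (i + 1)) (word (i + 2))) :
    factorCount 3 Q = (Finset.univ.filter fun x : Fin 2 × Fin 2 × Fin 2 =>
      ¬ (x.1 = x.2.1 ∧ x.2.1 = x.2.2) ∧ q x.1 x.2.1 x.2.2).card := by
  rw [← Set.ncard_coe_finset, factorCount]
  have hi : Function.Injective
      (fun x : Fin 2 × Fin 2 × Fin 2 => [x.1, x.2.1, x.2.2]) := by decide
  rw [← Set.ncard_image_of_injective _ hi]
  congr 1
  ext u
  constructor
  · rintro ⟨i, hi, rfl⟩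
    refine ⟨(word i, word (i + 1), word (i + 2)), ?_, rfl⟩
    simpa using ⟨not_and.1 (not_word_cube i), (h i).1 hi⟩
  · rintro ⟨⟨a, b, c⟩, hx, rfl⟩
    simp only [Finset.coe_filter, Finset.mem_univ, true_and, Set.mem_ofPred_eq] at hx
    obtain ⟨i, rfl, rfl, rfl⟩ := exists_word_triple a b c hx.1
    exact ⟨i, (h i).2 hx.2, rfl⟩

theorem factorCount_two {Q : ℕ → Prop} (q : Fin 2 → Fin 2 → Prop)
    [∀ a b, Decidable (q a b)] (h : ∀ i, Q i ↔ q (word i) (word (i + 1))) :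
    factorCount 2 Q = (Finset.univ.filter fun x : Fin 2 × Fin 2 => q x.1 x.2).card := by
  rw [← Set.ncard_coe_finset, factorCount]
  have hi : Function.Injective (fun x : Fin 2 × Fin 2 => [x.1, x.2]) := by decide
  rw [← Set.ncard_image_of_injective _ hi]
  congr 1
  ext u
  constructor
  · rintro ⟨i, hi, rfl⟩
    exact ⟨(word i, word (i + 1)), by simpa using (h i).1 hi, rfl⟩
  · rintro ⟨⟨a, b⟩, hx, rfl⟩
    simp only [Finset.coe_filter, Finset.mem_univ, true_and, Set.mem_ofPred_eq] at hx
    -- The third letter is chosen different from the second, so that the triple is not a cube.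
    obtain ⟨i, rfl, rfl, -⟩ := exists_word_triple a b (b + 1) (by clear hx; revert a b; decide)
    exact ⟨i, (h i).2 hx, rfl⟩

/-! ### Abelian squares in terms of prefix counts. -/

/-- The number of ones in the prefix of length `m` of the Thue-Morse word. -/
def ones (m : ℕ) : ℕ := (factorAt word 0 m).count 1

theorem factorAt_add (t : ℕ → Fin 2) (i m n : ℕ) :
    factorAt t i (m + n) = factorAt t i m ++ factorAt t (i + m) n := by
  simp [factorAt, List.range_add, add_assoc]

theorem ones_add (i n : ℕ) : ones (i + n) = ones i + (factorAt word i n).count 1 := by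
  rw [ones, factorAt_add, List.count_append, zero_add, ones]

theorem ones_succ (i : ℕ) : ones (i + 1) = ones i + word i := by
  rw [ones_add]
  have : factorAt word i 1 = [word i] := rfl
  rw [this]
  generalize word i = a
  congr 1
  revert a; decide

theorem ones_two_mul (j : ℕ) : ones (2 * j) = j := by
  induction j with
  | zero => rfl
  | succ j ih =>
    rw [show 2 * (j + 1) = 2 * j + 1 + 1 by ring, ones_succ, ones_succ, ih, word_two_mul,
      word_two_mul_add_one, add_assoc]
    congr 1
    generalize word j = a
    revert a; decide

theorem ones_two_mul_add_one (j : ℕ) : ones (2 * j + 1) = j + word j := by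
  rw [ones_succ, ones_two_mul, word_two_mul]

theorem length_eq_sum_parikh (u : List (Fin 2)) : u.length = parikh u 0 + parikh u 1 := by
  induction u with
  | nil => rfl
  | cons a u ih =>
    simp only [parikh, List.length_cons, List.count_cons] at *
    fin_cases a <;> simp <;> omega

theorem length_factorAt (t : ℕ → Fin 2) (i m : ℕ) : (factorAt t i m).length = m := by
  simp [factorAt]

/-- The two halves have the same length, so comparing their numbers of ones is enough, and these are
differences of prefix counts. -/
theorem parikh_factorAt_eq_iff (i n : ℕ) :
    parikh (factorAt word i n) = parikh (factorAt word (i + n) n) ↔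
      2 * ones (i + n) = ones i + ones (i + 2 * n) := by
  have h1 := ones_add i n
  have h2 := ones_add (i + n) n
  rw [add_assoc, ← two_mul] at h2
  have l1 := length_eq_sum_parikh (factorAt word i n)
  have l2 := length_eq_sum_parikh (factorAt word (i + n) n)
  rw [length_factorAt] at l1 l2
  constructor
  · intro h
    have := congrFun h 1
    simp only [parikh] at this
    omega
  · intro h
    funext a
    have : ∀ u, parikh u 1 = u.count 1 := fun u => rfl
    fin_cases a
    · change parikh _ 0 = parikh _ 0
      simp only [this] at l1 l2
      omega
    · change List.count 1 _ = List.count 1 _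
      omega

theorem f_eq_factorCount (n : ℕ) :
    f n = factorCount (2 * n) (fun i => 2 * ones (i + n) = ones i + ones (i + 2 * n)) := by
  rw [f, factorCount]
  congr 1
  ext u
  constructor
  · rintro ⟨⟨i, hi⟩, x, y, rfl, hx, hxy⟩
    have hy : y.length = n := by
      rw [length_eq_sum_parikh, ← hxy, ← length_eq_sum_parikh, hx]
    rw [List.length_append, hx, hy, ← two_mul] at hi
    refine ⟨i, ?_, hi.symm⟩
    rw [two_mul, factorAt_add] at hi
    obtain ⟨rfl, rfl⟩ := List.append_inj hi (by rw [hx, length_factorAt])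
    exact (parikh_factorAt_eq_iff i n).1 hxy
  · rintro ⟨i, hi, rfl⟩
    refine ⟨⟨i, by simp only [length_factorAt]⟩, _, _, ?_, length_factorAt word i n,
      (parikh_factorAt_eq_iff i n).2 hi⟩
    simp only [two_mul, factorAt_add]

/-! ### Recurrences for the auxiliary counts and for `f`. -/

/-- The subword complexity of the Thue-Morse word. -/
noncomputable def complexity (n : ℕ) : ℕ := factorCount n (fun _ => True)

/-- The number of factors of length `n + 1` whose extreme letters have sum `α`. -/
noncomputable def pairCount (n : ℕ) (α : Fin 2) : ℕ :=
  factorCount (n + 1) (fun i => word i + word (i + n) = α)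

/-- The number of factors of length `b + 1` whose initial letter has sum `α` with the letter at
position `a` and sum `β` with the last letter. -/
noncomputable def tripleCount (a b : ℕ) (α β : Fin 2) : ℕ :=
  factorCount (b + 1) (fun i => word i + word (i + a) = α ∧ word i + word (i + b) = β)

/-- Here and in the recurrences below, the lower bound on the parameter ensures that the factors
being split have length at least 4. -/
theorem complexity_two_mul {n : ℕ} (hn : 2 ≤ n) :
    complexity (2 * n) = complexity n + complexity (n + 1) := by
  rw [complexity, factorCount_split (by omega)]
  exact congrArg₂ _ (factorCount_congr (by omega) fun _ => Iff.rfl)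
    (factorCount_congr (by omega) fun _ => Iff.rfl)

theorem complexity_two_mul_add_one {n : ℕ} (hn : 2 ≤ n) :
    complexity (2 * n + 1) = complexity (n + 1) + complexity (n + 1) := by
  rw [complexity, factorCount_split (by omega)]
  exact congrArg₂ _ (factorCount_congr (by omega) fun _ => Iff.rfl)
    (factorCount_congr (by omega) fun _ => Iff.rfl)

theorem two_mul_add_one_add_two_mul (a b : ℕ) : 2 * a + 1 + 2 * b = 2 * (a + b) + 1 := by ring

theorem two_mul_add_two_mul_add_one (a b : ℕ) : 2 * a + (2 * b + 1) = 2 * (a + b) + 1 := by ring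

theorem two_mul_add_one_add_two_mul_add_one (a b : ℕ) :
    2 * a + 1 + (2 * b + 1) = 2 * (a + (b + 1)) := by ring

theorem add_one_add_add_one (a b : Fin 2) : a + 1 + (b + 1) = a + b := by revert a b; decide

theorem add_one_add_eq_iff (a b c : Fin 2) : a + 1 + b = c ↔ a + b = c + 1 := by
  revert a b c; decide

theorem add_add_one_eq_iff (a b c : Fin 2) : a + (b + 1) = c ↔ a + b = c + 1 := by
  revert a b c; decide

/-- Passing to the preimage flips a letter exactly when it sits at an odd position. Letters at an
even distance are both flipped or both kept, so their sum modulo 2 is unchanged; an odd distance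
changes the sum by 1. The recurrences for `tripleCount` follow the same rule for each of the two
sums. -/
theorem pairCount_two_mul {n : ℕ} (hn : 2 ≤ n) (α : Fin 2) :
    pairCount (2 * n) α = pairCount n α + pairCount n α := by
  rw [pairCount, factorCount_split (by omega)]
  refine congrArg₂ _ (factorCount_congr (by omega) fun j => ?_)
    (factorCount_congr (by omega) fun j => ?_)
  · rw [← mul_add, word_two_mul, word_two_mul]
  · rw [two_mul_add_one_add_two_mul, word_two_mul_add_one, word_two_mul_add_one,
      add_one_add_add_one]

theorem pairCount_two_mul_add_one {n : ℕ} (hn : 1 ≤ n) (α : Fin 2) :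
    pairCount (2 * n + 1) α = pairCount n (α + 1) + pairCount (n + 1) (α + 1) := by
  rw [pairCount, factorCount_split (by omega)]
  refine congrArg₂ _ (factorCount_congr (by omega) fun j => ?_)
    (factorCount_congr (by omega) fun j => ?_)
  · rw [two_mul_add_two_mul_add_one, word_two_mul, word_two_mul_add_one, add_add_one_eq_iff]
  · rw [two_mul_add_one_add_two_mul_add_one, word_two_mul, word_two_mul_add_one,
      add_one_add_eq_iff]

theorem tripleCount_even_even {a b : ℕ} (hb : 2 ≤ b) (α β : Fin 2) :
    tripleCount (2 * a) (2 * b) α β = tripleCount a b α β + tripleCount a b α β := by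
  rw [tripleCount, factorCount_split (by omega)]
  refine congrArg₂ _ (factorCount_congr (by omega) fun j => ?_)
    (factorCount_congr (by omega) fun j => ?_)
  · simp only [← mul_add, word_two_mul]
  · simp only [two_mul_add_one_add_two_mul, word_two_mul_add_one, add_one_add_add_one]

theorem tripleCount_even_odd {a b : ℕ} (hb : 1 ≤ b) (α β : Fin 2) :
    tripleCount (2 * a) (2 * b + 1) α β =
      tripleCount a b α (β + 1) + tripleCount a (b + 1) α (β + 1) := by
  rw [tripleCount, factorCount_split (by omega)]
  refine congrArg₂ _ (factorCount_congr (by omega) fun j => ?_)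
    (factorCount_congr (by omega) fun j => ?_)
  · simp only [← mul_add, word_two_mul, two_mul_add_two_mul_add_one, word_two_mul_add_one,
      add_add_one_eq_iff]
  · simp only [two_mul_add_one_add_two_mul, two_mul_add_one_add_two_mul_add_one,
      word_two_mul, word_two_mul_add_one, add_one_add_add_one, add_one_add_eq_iff]

theorem tripleCount_odd_even {a b : ℕ} (hb : 2 ≤ b) (α β : Fin 2) :
    tripleCount (2 * a + 1) (2 * b) α β =
      tripleCount a b (α + 1) β + tripleCount (a + 1) b (α + 1) β := by
  rw [tripleCount, factorCount_split (by omega)]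
  refine congrArg₂ _ (factorCount_congr (by omega) fun j => ?_)
    (factorCount_congr (by omega) fun j => ?_)
  · simp only [← mul_add, word_two_mul, two_mul_add_two_mul_add_one, word_two_mul_add_one,
      add_add_one_eq_iff]
  · simp only [two_mul_add_one_add_two_mul, two_mul_add_one_add_two_mul_add_one,
      word_two_mul, word_two_mul_add_one, add_one_add_add_one, add_one_add_eq_iff]

theorem tripleCount_odd_odd {a b : ℕ} (hb : 1 ≤ b) (α β : Fin 2) :
    tripleCount (2 * a + 1) (2 * b + 1) α β =
      tripleCount a b (α + 1) (β + 1) + tripleCount (a + 1) (b + 1) (α + 1) (β + 1) := by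
  rw [tripleCount, factorCount_split (by omega)]
  refine congrArg₂ _ (factorCount_congr (by omega) fun j => ?_)
    (factorCount_congr (by omega) fun j => ?_)
  · simp only [word_two_mul, two_mul_add_two_mul_add_one, word_two_mul_add_one,
      add_add_one_eq_iff]
  · simp only [two_mul_add_one_add_two_mul_add_one,
      word_two_mul, word_two_mul_add_one, add_one_add_eq_iff]

theorem f_two_mul {n : ℕ} (hn : 1 ≤ n) :
    f (2 * n) = complexity (2 * n) + tripleCount n (2 * n) 0 0 := by
  rw [f_eq_factorCount, factorCount_split (by omega)]
  refine congrArg₂ _ (factorCount_congr (by omega) fun j => ?_)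
    (factorCount_congr (by omega) fun j => ?_)
  · simp only [← mul_add, ones_two_mul]
    exact iff_true_intro (by ring)
  · simp only [two_mul_add_one_add_two_mul, ones_two_mul_add_one]
    generalize word j = a
    generalize word (j + n) = b
    generalize word (j + 2 * n) = c
    -- For letters in {0, 1} the equation on the right says that all three agree, hence the sums 0,
    -- 0.
    have h : 2 * (j + n + b) = j + a + (j + 2 * n + c) ↔ 2 * (b : ℕ) = a + c := by omega
    rw [h]
    clear h
    revert a b c; decide

theorem f_two_mul_add_one {n : ℕ} (hn : 1 ≤ n) : f (2 * n + 1) = pairCount (2 * n + 1) 1 := by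
  -- The even positions contribute nothing: there the two sides of the abelian square equation have
  -- opposite parities.
  rw [f_eq_factorCount, factorCount_split (by omega), ← zero_add (pairCount _ _),
    ← factorCount_false (2 * n + 1)]
  refine congrArg₂ _ (factorCount_congr (by omega) fun j => ?_)
    (factorCount_congr (by omega) fun j => ?_)
  · simp only [← mul_add, ones_two_mul, two_mul_add_two_mul_add_one, ones_two_mul_add_one]
    exact iff_false_intro (by omega)
  · simp only [two_mul_add_one_add_two_mul_add_one, two_mul_add_one_add_two_mul, ones_two_mul,
      ones_two_mul_add_one]
    generalize word j = a
    generalize word (j + (2 * n + 1)) = c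
    have h : 2 * (j + (n + 1)) = j + a + (j + (2 * n + 1) + c) ↔ (a : ℕ) + c = 1 := by omega
    rw [h]
    clear h
    revert a c; decide

theorem f_two_mul_eq {n : ℕ} (hn : 2 ≤ n) :
    f (2 * n) = complexity n + complexity (n + 1) + tripleCount n (2 * n) 0 0 := by
  rw [f_two_mul (by omega), complexity_two_mul hn]

theorem f_two_mul_add_one_eq {n : ℕ} (hn : 1 ≤ n) :
    f (2 * n + 1) = pairCount n 0 + pairCount (n + 1) 0 := by
  rw [f_two_mul_add_one hn, pairCount_two_mul_add_one hn]
  -- The sum `1 + 1` is `0` in `Fin 2`.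
  rfl

theorem complexity_two_mul_add_two {n : ℕ} (hn : 1 ≤ n) :
    complexity (2 * n + 2) = complexity (n + 1) + complexity (n + 2) :=
  complexity_two_mul (n := n + 1) (by omega)

theorem complexity_two_mul_add_three {n : ℕ} (hn : 1 ≤ n) :
    complexity (2 * n + 3) = complexity (n + 2) + complexity (n + 2) :=
  complexity_two_mul_add_one (n := n + 1) (by omega)

theorem pairCount_two_mul_add_two {n : ℕ} (hn : 1 ≤ n) (α : Fin 2) :
    pairCount (2 * n + 2) α = pairCount (n + 1) α + pairCount (n + 1) α :=
  pairCount_two_mul (n := n + 1) (by omega) α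

theorem tripleCount_two_mul {n : ℕ} (hn : 1 ≤ n) (α β : Fin 2) :
    tripleCount (2 * n) (2 * (2 * n)) α β =
      tripleCount n (2 * n) α β + tripleCount n (2 * n) α β :=
  tripleCount_even_even (a := n) (b := 2 * n) (by omega) α β

theorem tripleCount_two_mul_add_one {n : ℕ} (hn : 1 ≤ n) (α β : Fin 2) :
    tripleCount (2 * n + 1) (2 * (2 * n + 1)) α β =
      tripleCount n (2 * n + 1) (α + 1) β + tripleCount (n + 1) (2 * n + 1) (α + 1) β :=
  tripleCount_odd_even (a := n) (b := 2 * n + 1) (by omega) α β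

theorem tripleCount_two_mul_add_two {n : ℕ} (hn : 1 ≤ n) (α β : Fin 2) :
    tripleCount (2 * n + 1 + 1) (2 * (2 * n + 1 + 1)) α β =
      tripleCount (n + 1) (2 * (n + 1)) α β + tripleCount (n + 1) (2 * (n + 1)) α β :=
  tripleCount_even_even (a := n + 1) (b := 2 * (n + 1)) (by omega) α β

theorem tripleCount_left_two_mul {n : ℕ} (hn : 1 ≤ n) (α β : Fin 2) :
    tripleCount (2 * n) (2 * (2 * n) + 1) α β =
      tripleCount n (2 * n) α (β + 1) + tripleCount n (2 * n + 1) α (β + 1) :=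
  tripleCount_even_odd (a := n) (b := 2 * n) (by omega) α β

theorem tripleCount_left_two_mul_add_one {n : ℕ} (hn : 1 ≤ n) (α β : Fin 2) :
    tripleCount (2 * n + 1) (2 * (2 * n + 1) + 1) α β =
      tripleCount n (2 * n + 1) (α + 1) (β + 1) + tripleCount (n + 1) (2 * (n + 1)) (α + 1) (β + 1) :=
  tripleCount_odd_odd (a := n) (b := 2 * n + 1) (by omega) α β

theorem tripleCount_right_two_mul {n : ℕ} (hn : 1 ≤ n) (α β : Fin 2) :
    tripleCount (2 * n + 1) (2 * (2 * n) + 1) α β =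
      tripleCount n (2 * n) (α + 1) (β + 1) + tripleCount (n + 1) (2 * n + 1) (α + 1) (β + 1) :=
  tripleCount_odd_odd (a := n) (b := 2 * n) (by omega) α β

theorem tripleCount_right_two_mul_add_one {n : ℕ} (hn : 1 ≤ n) (α β : Fin 2) :
    tripleCount (2 * n + 1 + 1) (2 * (2 * n + 1) + 1) α β =
      tripleCount (n + 1) (2 * n + 1) α (β + 1) + tripleCount (n + 1) (2 * (n + 1)) α (β + 1) :=
  tripleCount_even_odd (a := n + 1) (b := 2 * n + 1) (by omega) α β

/-! ### Initial values. -/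

theorem f_zero : f 0 = 1 := by
  rw [f_eq_factorCount, factorCount]
  have : (fun i => factorAt word i (2 * 0)) '' {i | 2 * ones (i + 0) = ones i + ones (i + 2 * 0)} =
      {[]} := by
    ext u
    constructor
    · rintro ⟨i, -, rfl⟩
      rfl
    · rintro rfl
      exact ⟨0, rfl, rfl⟩
  rw [this, Set.ncard_singleton]

theorem f_one : f 1 = 2 := by
  rw [f_eq_factorCount, factorCount_two (fun a b => a = b)]
  · decide
  · intro i
    rw [show i + 2 * 1 = i + 1 + 1 by ring, ones_succ, ones_succ, ones_succ]
    omega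

theorem complexity_two : complexity 2 = 4 := by
  rw [complexity, factorCount_two (fun _ _ => True) fun _ => Iff.rfl]
  decide

theorem complexity_three : complexity 3 = 6 := by
  rw [complexity, factorCount_three (fun _ _ _ => True) fun _ => Iff.rfl]
  decide

theorem pairCount_one (α : Fin 2) : pairCount 1 α = 2 := by
  rw [pairCount, factorCount_two (fun a b => a + b = α) fun _ => Iff.rfl]
  revert α; decide

theorem pairCount_two (α : Fin 2) : pairCount 2 α = ![2, 4] α := by
  rw [pairCount, factorCount_three (fun a _ c => a + c = α) fun _ => Iff.rfl]
  revert α; decide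

theorem tripleCount_one_two (α β : Fin 2) : tripleCount 1 2 α β = ![![0, 2], ![2, 2]] α β := by
  rw [tripleCount, factorCount_three (fun a b c => a + b = α ∧ a + c = β) fun _ => Iff.rfl]
  revert α β; decide

theorem tripleCount_zero_one (α β : Fin 2) : tripleCount 0 1 α β = ![![2, 2], ![0, 0]] α β := by
  rw [tripleCount, factorCount_two (Q := fun i => word i + word (i + 0) = α ∧ word i + word (i + 1) = β)
    (fun a b => a + a = α ∧ a + b = β) fun _ => Iff.rfl]
  revert α β; decide

theorem tripleCount_one_one (α β : Fin 2) : tripleCount 1 1 α β = ![![2, 0], ![0, 2]] α β := by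
  rw [tripleCount, factorCount_two (fun a b => a + b = α ∧ a + b = β) fun _ => Iff.rfl]
  revert α β; decide

theorem tripleCount_one_three (α β : Fin 2) :
    tripleCount 1 3 α β = ![![2, 2], ![4, 2]] α β := by
  rw [tripleCount_odd_odd (a := 0) (b := 1) (by omega), tripleCount_zero_one, tripleCount_one_two]
  revert α β; decide

theorem tripleCount_two_three (α β : Fin 2) :
    tripleCount 2 3 α β = ![![2, 2], ![4, 2]] α β := by
  rw [tripleCount_even_odd (a := 1) (b := 1) (by omega), tripleCount_one_one, tripleCount_one_two]
  revert α β; decide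

theorem tripleCount_two_four (α β : Fin 2) :
    tripleCount 2 4 α β = ![![0, 4], ![4, 4]] α β := by
  rw [tripleCount_even_even (a := 1) (b := 2) le_rfl, tripleCount_one_two]
  revert α β; decide

theorem tripleCount_three_six (α β : Fin 2) :
    tripleCount 3 6 α β = ![![8, 4], ![4, 4]] α β := by
  rw [tripleCount_odd_even (a := 1) (b := 3) (by omega), tripleCount_one_three,
    tripleCount_two_three]
  revert α β; decide

/-! ### The linear representation over ℚ. -/

/-- The row vector `v * M_{a₁} * ⋯ * M_{aᵢ}` attached to the binary digits of `n`. -/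
def coords (n : ℕ) : Fin 11 → ℚ := v ᵥ* ((binary n).map M).prod

/-- A new least significant digit multiplies on the right. For `n = 0` no digit is added, since zero
has the empty expansion. -/
theorem coords_two_mul {n : ℕ} (hn : n ≠ 0) : coords (2 * n) = coords n ᵥ* M₀ := by
  have h : Nat.digits 2 (2 * n) = 0 :: Nat.digits 2 n := by
    have := Nat.digits_add 2 one_lt_two 0 n two_pos (Or.inr hn)
    rwa [zero_add] at this
  rw [coords, binary, h]
  simp [coords, binary, M, Matrix.vecMul_vecMul]

theorem coords_two_mul_add_one (n : ℕ) : coords (2 * n + 1) = coords n ᵥ* M₁ := by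
  have h : Nat.digits 2 (2 * n + 1) = 1 :: Nat.digits 2 n := by
    have := Nat.digits_add 2 one_lt_two 1 n one_lt_two (Or.inl one_ne_zero)
    rwa [add_comm] at this
  rw [coords, binary, h]
  simp [coords, binary, M, Matrix.vecMul_vecMul]

theorem coords_zero : coords 0 = v := by simp [coords, binary]

/-- The values of `complexity (n + 0)` for `n ≤ 10`. -/
def complexityVec0 : Fin 11 → ℚ := ![1, 2, 4, 6, 10, 12, 16, 20, 22, 24, 28]

/-- The values of `complexity (n + 1)` for `n ≤ 10`. -/
def complexityVec1 : Fin 11 → ℚ := ![2, 4, 6, 10, 12, 16, 20, 22, 24, 28, 32]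

/-- The values of `complexity (n + 2)` for `n ≤ 10`. -/
def complexityVec2 : Fin 11 → ℚ := ![4, 6, 10, 12, 16, 20, 22, 24, 28, 32, 36]

/-- The values of `pairCount (n + 0)` for `n ≤ 10`. -/
def pairVec0 : Fin 2 → Fin 11 → ℚ :=
  ![![2, 2, 2, 6, 4, 8, 12, 12, 8, 16, 16],
    ![0, 2, 4, 4, 8, 8, 8, 10, 16, 12, 16]]

/-- The values of `pairCount (n + 1)` for `n ≤ 10`. -/
def pairVec1 : Fin 2 → Fin 11 → ℚ :=
  ![![2, 2, 6, 4, 8, 12, 12, 8, 16, 16, 16],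
    ![2, 4, 4, 8, 8, 8, 10, 16, 12, 16, 20]]

/-- The values of `tripleCount n (2 * n)` for `n ≤ 10`. -/
def tripleVec : Fin 2 → Fin 2 → Fin 11 → ℚ :=
  ![![![2, 0, 0, 8, 0, 8, 16, 12, 0, 20, 16],
      ![0, 2, 4, 4, 8, 8, 8, 10, 16, 12, 16]],
    ![![0, 2, 4, 4, 8, 8, 8, 12, 16, 12, 16],
      ![0, 2, 4, 4, 8, 8, 8, 10, 16, 12, 16]]]

/-- The values of `tripleCount (n + 1) (2 * (n + 1))` for `n ≤ 10`. -/
def tripleVecSucc : Fin 2 → Fin 2 → Fin 11 → ℚ :=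
  ![![![0, 0, 8, 0, 8, 16, 12, 0, 20, 16, 12],
      ![2, 4, 4, 8, 8, 8, 10, 16, 12, 16, 20]],
    ![![2, 4, 4, 8, 8, 8, 12, 16, 12, 16, 20],
      ![2, 4, 4, 8, 8, 8, 10, 16, 12, 16, 20]]]

/-- The values of `tripleCount n (2 * n + 1)` for `n ≤ 10`. -/
def tripleVecLeft : Fin 2 → Fin 2 → Fin 11 → ℚ :=
  ![![![2, 2, 4, 6, 6, 10, 12, 10, 12, 16, 16],
      ![2, 2, 2, 8, 4, 8, 14, 14, 6, 18, 18]],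
    ![![0, 4, 4, 6, 10, 6, 6, 16, 16, 12, 20],
      ![0, 2, 6, 2, 8, 12, 10, 6, 18, 14, 14]]]

/-- The values of `tripleCount (n + 1) (2 * n + 1)` for `n ≤ 10`. -/
def tripleVecRight : Fin 2 → Fin 2 → Fin 11 → ℚ :=
  ![![![2, 2, 4, 6, 6, 10, 12, 10, 12, 16, 16],
      ![0, 2, 6, 2, 8, 12, 10, 6, 18, 14, 14]],
    ![![0, 4, 4, 6, 10, 6, 6, 16, 16, 12, 20],
      ![2, 2, 2, 8, 4, 8, 14, 14, 6, 18, 18]]]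

/-- The counts of factors attached to `n` are linear in `coords n`. -/
structure IsLinear (n : ℕ) : Prop where
  coords_zero : coords n 0 = 0
  coords_one : coords n 1 = 0
  f : (f n : ℚ) = coords n ⬝ᵥ w
  complexity0 : (complexity n : ℚ) = coords n ⬝ᵥ complexityVec0
  complexity1 : (complexity (n + 1) : ℚ) = coords n ⬝ᵥ complexityVec1
  complexity2 : (complexity (n + 2) : ℚ) = coords n ⬝ᵥ complexityVec2
  pair0 : ∀ α, (pairCount n α : ℚ) = coords n ⬝ᵥ pairVec0 α
  pair1 : ∀ α, (pairCount (n + 1) α : ℚ) = coords n ⬝ᵥ pairVec1 α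
  triple : ∀ α β, (tripleCount n (2 * n) α β : ℚ) = coords n ⬝ᵥ tripleVec α β
  triple_succ : ∀ α β,
    (tripleCount (n + 1) (2 * (n + 1)) α β : ℚ) = coords n ⬝ᵥ tripleVecSucc α β
  triple_left : ∀ α β, (tripleCount n (2 * n + 1) α β : ℚ) = coords n ⬝ᵥ tripleVecLeft α β
  triple_right : ∀ α β,
    (tripleCount (n + 1) (2 * n + 1) α β : ℚ) = coords n ⬝ᵥ tripleVecRight α β

/-- This frees the induction from coordinates 0 and 1, where the vector identities may fail because
the recurrences do not all hold at n = 0, 1. -/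
theorem dotProduct_eq_of_tail {x y z : Fin 11 → ℚ} (h0 : x 0 = 0) (h1 : x 1 = 0)
    (h : ∀ i, 2 ≤ i → y i = z i) : x ⬝ᵥ y = x ⬝ᵥ z := by
  refine Finset.sum_congr rfl fun i _ => ?_
  by_cases hi : 2 ≤ i
  · rw [h i hi]
  · obtain rfl | rfl : i = 0 ∨ i = 1 := by revert i; decide
    · rw [h0, zero_mul, zero_mul]
    · rw [h1, zero_mul, zero_mul]

theorem coords_two : coords 2 = Pi.single 2 1 := by
  rw [show 2 = 2 * 1 by rfl, coords_two_mul one_ne_zero, show 1 = 2 * 0 + 1 by rfl,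
    coords_two_mul_add_one, coords_zero]
  decide +kernel

theorem coords_three : coords 3 = Pi.single 3 1 := by
  rw [show 3 = 2 * 1 + 1 by rfl, coords_two_mul_add_one, show 1 = 2 * 0 + 1 by rfl,
    coords_two_mul_add_one, coords_zero]
  decide +kernel

theorem coords_two_dotProduct (y : Fin 11 → ℚ) : coords 2 ⬝ᵥ y = y 2 := by
  rw [coords_two, single_dotProduct, one_mul]

theorem coords_three_dotProduct (y : Fin 11 → ℚ) : coords 3 ⬝ᵥ y = y 3 := by
  rw [coords_three, single_dotProduct, one_mul]

theorem complexity_four : complexity 4 = 10 := by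
  rw [complexity_two_mul (n := 2) le_rfl, complexity_two, complexity_three]

theorem complexity_five : complexity 5 = 12 := by
  rw [complexity_two_mul_add_one (n := 2) le_rfl, complexity_three]

theorem pairCount_three (α : Fin 2) : pairCount 3 α = ![6, 4] α := by
  rw [pairCount_two_mul_add_one (n := 1) le_rfl, pairCount_one, pairCount_two]
  revert α; decide

theorem pairCount_four (α : Fin 2) : pairCount 4 α = ![4, 8] α := by
  rw [pairCount_two_mul (n := 2) le_rfl, pairCount_two]
  revert α; decide

theorem isLinear_two : IsLinear 2 := by
  constructor <;> intros <;> (try rw [coords_two_dotProduct])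
  · rw [coords_two]; rfl
  · rw [coords_two]; rfl
  · rw [f_two_mul (n := 1) le_rfl, complexity_two, tripleCount_one_two]
    decide +kernel
  · rw [complexity_two]; decide +kernel
  · rw [complexity_three]; decide +kernel
  · rw [complexity_four]; decide +kernel
  · rename_i α; rw [pairCount_two]; revert α; decide +kernel
  · rename_i α; rw [pairCount_three]; revert α; decide +kernel
  · rename_i α β; rw [tripleCount_two_four]; revert α β; decide +kernel
  · rename_i α β; rw [tripleCount_three_six]; revert α β; decide +kernel
  · rename_i α β
    rw [tripleCount_even_odd (a := 1) (b := 2) one_le_two, tripleCount_one_two,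
      tripleCount_one_three]
    revert α β; decide +kernel
  · rename_i α β
    rw [tripleCount_odd_odd (a := 1) (b := 2) one_le_two, tripleCount_one_two,
      tripleCount_two_three]
    revert α β; decide +kernel

theorem isLinear_three : IsLinear 3 := by
  constructor <;> intros <;> (try rw [coords_three_dotProduct])
  · rw [coords_three]; rfl
  · rw [coords_three]; rfl
  · rw [f_two_mul_add_one (n := 1) le_rfl, pairCount_three]
    decide +kernel
  · rw [complexity_three]; decide +kernel
  · rw [complexity_four]; decide +kernel
  · rw [complexity_five]; decide +kernel
  · rename_i α; rw [pairCount_three]; revert α; decide +kernel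
  · rename_i α; rw [pairCount_four]; revert α; decide +kernel
  · rename_i α β; rw [tripleCount_three_six]; revert α β; decide +kernel
  · rename_i α β
    rw [tripleCount_even_even (a := 2) (b := 4) (by omega), tripleCount_two_four]
    revert α β; decide +kernel
  · rename_i α β
    rw [tripleCount_odd_odd (a := 1) (b := 3) (by omega), tripleCount_one_three,
      tripleCount_two_four]
    revert α β; decide +kernel
  · rename_i α β
    rw [tripleCount_even_odd (a := 2) (b := 3) (by omega), tripleCount_two_three,
      tripleCount_two_four]
    revert α β; decide +kernel

/-- A recurrence writes the count at 2n as `coords n ⬝ᵥ z`, while the claim is that it equals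
`coords n ⬝ᵥ (M₀ *ᵥ y)`. So it suffices that `z` and `M₀ *ᵥ y` agree in rows 2 to 10, a finite
computation for each count. -/
theorem IsLinear.two_mul {n : ℕ} (hn : 2 ≤ n) (h : IsLinear n) : IsLinear (2 * n) := by
  have hn' : 1 ≤ n := by omega
  have step : ∀ y z : Fin 11 → ℚ, (∀ i, 2 ≤ i → z i = (M₀ *ᵥ y) i) →
      coords n ⬝ᵥ z = coords (2 * n) ⬝ᵥ y := fun y z hz => by
    rw [coords_two_mul (by omega), ← Matrix.dotProduct_mulVec]
    exact dotProduct_eq_of_tail h.coords_zero h.coords_one hz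
  have col : ∀ j, (∀ i, 2 ≤ i → M₀ i j = 0) → coords (2 * n) j = 0 := fun j hj => by
    -- The case of `step` where `y` is the `j`-th unit vector, so that `M₀ *ᵥ y` is a column
    -- vanishing in the relevant rows.
    rw [← dotProduct_single_one (coords (2 * n)) j, ← step _ 0, dotProduct_zero]
    intro i hi
    rw [Matrix.mulVec_single_one, Matrix.col_apply, hj i hi, Pi.zero_apply]
  constructor
  · exact col 0 (by decide +kernel)
  · exact col 1 (by decide +kernel)
  · rw [f_two_mul_eq hn]
    push_cast
    rw [h.complexity0, h.complexity1, h.triple, ← dotProduct_add, ← dotProduct_add]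
    exact step _ _ (by decide +kernel)
  · rw [complexity_two_mul hn, Nat.cast_add, h.complexity0, h.complexity1, ← dotProduct_add]
    exact step _ _ (by decide +kernel)
  · rw [complexity_two_mul_add_one hn, Nat.cast_add, h.complexity1, ← dotProduct_add]
    exact step _ _ (by decide +kernel)
  · rw [complexity_two_mul_add_two hn', Nat.cast_add, h.complexity1, h.complexity2,
      ← dotProduct_add]
    exact step _ _ (by decide +kernel)
  · intro α
    rw [pairCount_two_mul hn, Nat.cast_add, h.pair0, ← dotProduct_add]
    exact step _ _ (by revert α; decide +kernel)
  · intro α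
    rw [pairCount_two_mul_add_one hn', Nat.cast_add, h.pair0, h.pair1, ← dotProduct_add]
    exact step _ _ (by revert α; decide +kernel)
  · intro α β
    rw [tripleCount_two_mul hn', Nat.cast_add, h.triple, ← dotProduct_add]
    exact step _ _ (by revert α β; decide +kernel)
  · intro α β
    rw [tripleCount_two_mul_add_one hn', Nat.cast_add, h.triple_left, h.triple_right,
      ← dotProduct_add]
    exact step _ _ (by revert α β; decide +kernel)
  · intro α β
    rw [tripleCount_left_two_mul hn', Nat.cast_add, h.triple, h.triple_left, ← dotProduct_add]
    exact step _ _ (by revert α β; decide +kernel)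
  · intro α β
    rw [tripleCount_right_two_mul hn', Nat.cast_add, h.triple, h.triple_right, ← dotProduct_add]
    exact step _ _ (by revert α β; decide +kernel)

theorem IsLinear.two_mul_add_one {n : ℕ} (hn : 2 ≤ n) (h : IsLinear n) :
    IsLinear (2 * n + 1) := by
  have hn' : 1 ≤ n := by omega
  have step : ∀ y z : Fin 11 → ℚ, (∀ i, 2 ≤ i → z i = (M₁ *ᵥ y) i) →
      coords n ⬝ᵥ z = coords (2 * n + 1) ⬝ᵥ y := fun y z hz => by
    rw [coords_two_mul_add_one, ← Matrix.dotProduct_mulVec]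
    exact dotProduct_eq_of_tail h.coords_zero h.coords_one hz
  have col : ∀ j, (∀ i, 2 ≤ i → M₁ i j = 0) → coords (2 * n + 1) j = 0 := fun j hj => by
    rw [← dotProduct_single_one (coords (2 * n + 1)) j, ← step _ 0, dotProduct_zero]
    intro i hi
    rw [Matrix.mulVec_single_one, Matrix.col_apply, hj i hi, Pi.zero_apply]
  constructor
  · exact col 0 (by decide +kernel)
  · exact col 1 (by decide +kernel)
  · rw [f_two_mul_add_one_eq hn', Nat.cast_add, h.pair0, h.pair1, ← dotProduct_add]
    exact step _ _ (by decide +kernel)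
  · rw [complexity_two_mul_add_one hn, Nat.cast_add, h.complexity1, ← dotProduct_add]
    exact step _ _ (by decide +kernel)
  · rw [complexity_two_mul_add_two hn', Nat.cast_add, h.complexity1, h.complexity2,
      ← dotProduct_add]
    exact step _ _ (by decide +kernel)
  · rw [complexity_two_mul_add_three hn', Nat.cast_add, h.complexity2, ← dotProduct_add]
    exact step _ _ (by decide +kernel)
  · intro α
    rw [pairCount_two_mul_add_one hn', Nat.cast_add, h.pair0, h.pair1, ← dotProduct_add]
    exact step _ _ (by revert α; decide +kernel)
  · intro α
    rw [pairCount_two_mul_add_two hn', Nat.cast_add, h.pair1, ← dotProduct_add]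
    exact step _ _ (by revert α; decide +kernel)
  · intro α β
    rw [tripleCount_two_mul_add_one hn', Nat.cast_add, h.triple_left, h.triple_right,
      ← dotProduct_add]
    exact step _ _ (by revert α β; decide +kernel)
  · intro α β
    rw [tripleCount_two_mul_add_two hn', Nat.cast_add, h.triple_succ, ← dotProduct_add]
    exact step _ _ (by revert α β; decide +kernel)
  · intro α β
    rw [tripleCount_left_two_mul_add_one hn', Nat.cast_add, h.triple_left, h.triple_succ,
      ← dotProduct_add]
    exact step _ _ (by revert α β; decide +kernel)
  · intro α β
    rw [tripleCount_right_two_mul_add_one hn', Nat.cast_add, h.triple_right, h.triple_succ,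
      ← dotProduct_add]
    exact step _ _ (by revert α β; decide +kernel)

theorem isLinear_of_two_le (n : ℕ) (hn : 2 ≤ n) : IsLinear n := by
  induction n using Nat.strong_induction_on with
  | _ n ih =>
    by_cases h4 : n < 4
    · obtain rfl | rfl : n = 2 ∨ n = 3 := by omega
      · exact isLinear_two
      · exact isLinear_three
    · obtain ⟨m, rfl | rfl⟩ := Nat.even_or_odd' n
      · exact (ih m (by omega) (by omega)).two_mul (by omega)
      · exact (ih m (by omega) (by omega)).two_mul_add_one (by omega)

theorem f_eq_coords_dotProduct (n : ℕ) : (f n : ℚ) = coords n ⬝ᵥ w := by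
  by_cases hn : 2 ≤ n
  · exact (isLinear_of_two_le n hn).f
  · obtain rfl | rfl : n = 0 ∨ n = 1 := by omega
    · rw [f_zero, coords_zero]
      decide +kernel
    · rw [f_one, show 1 = 2 * 0 + 1 by rfl, coords_two_mul_add_one, coords_zero]
      decide +kernel

/-! ### 2-regularity over ℤ. -/

/-- A sequence lying in a finitely generated module of sequences that is stable under
`g ↦ g (2 * ·)` and `g ↦ g (2 * · + 1)` is `2`-regular. -/
theorem isRegular_two_of_mem {W : Submodule ℤ (ℕ → ℤ)} (hW : W.FG) {s : ℕ → ℤ} (hs : s ∈ W)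
    (h0 : ∀ g ∈ W, (fun n => g (2 * n)) ∈ W) (h1 : ∀ g ∈ W, (fun n => g (2 * n + 1)) ∈ W) :
    IsRegular 2 s := by
  have key : ∀ e r : ℕ, r < 2 ^ e → (fun n => s (2 ^ e * n + r)) ∈ W := by
    intro e
    induction e with
    | zero =>
      intro r hr
      obtain rfl : r = 0 := by simpa using hr
      simpa using hs
    | succ e ih =>
      intro r hr
      rw [pow_succ] at hr ⊢
      -- The leading bit of `r` decides which substitution applies: 2^(e+1) n + r equals 2^e (2n) +
      -- r, or 2^e (2n + 1) + (r - 2^e).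
      by_cases h : r < 2 ^ e
      · have := h0 _ (ih r h)
        simpa only [mul_assoc] using this
      · have := h1 _ (ih (r - 2 ^ e) (by omega))
        convert this using 3 with n
        rw [mul_add, mul_one, mul_assoc]
        omega
  have hle : Submodule.span ℤ (kernel 2 s) ≤ W := by
    rw [Submodule.span_le]
    rintro g ⟨e, r, hr, rfl⟩
    exact key e r hr
  have : Module.Finite ℤ W := Module.Finite.iff_fg.2 hW
  -- Since ℤ is Noetherian, the span of the kernel inherits finite generation from `W`.
  have : IsNoetherian ℤ W := isNoetherian_of_isNoetherianRing_of_finite ℤ W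
  have hfg := IsNoetherian.noetherian ((Submodule.span ℤ (kernel 2 s)).comap W.subtype)
  have := hfg.map W.subtype
  rwa [Submodule.map_comap_subtype, inf_eq_right.2 hle] at this

/-- The sequences of counts of factors that generate the `2`-kernel of `f`, together with the
sequences supported at `0` and at `1`. -/
noncomputable def generators : Set (ℕ → ℤ) :=
  {Pi.single 0 1, Pi.single 1 1, fun n => (f n : ℤ), fun n => (complexity n : ℤ),
    fun n => (complexity (n + 1) : ℤ), fun n => (complexity (n + 2) : ℤ)} ∪
  (Set.range (fun α n => (pairCount n α : ℤ)) ∪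
  Set.range (fun α n => (pairCount (n + 1) α : ℤ))) ∪
  (Set.range (fun (x : Fin 2 × Fin 2) n => (tripleCount n (2 * n) x.1 x.2 : ℤ)) ∪
  Set.range (fun (x : Fin 2 × Fin 2) n => (tripleCount (n + 1) (2 * (n + 1)) x.1 x.2 : ℤ)) ∪
  Set.range (fun (x : Fin 2 × Fin 2) n => (tripleCount n (2 * n + 1) x.1 x.2 : ℤ)) ∪
  Set.range (fun (x : Fin 2 × Fin 2) n => (tripleCount (n + 1) (2 * n + 1) x.1 x.2 : ℤ)))

theorem finite_generators : generators.Finite := by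
  unfold generators
  exact Set.toFinite _

/-- The module of sequences generated by the counts of factors. -/
noncomputable def countModule : Submodule ℤ (ℕ → ℤ) := Submodule.span ℤ generators

/-- The sequences supported at 0 and at 1 correct the first two values, so recurrences valid from 2
on give membership. -/
theorem mem_countModule_of_eq {g g' : ℕ → ℤ} (hg' : g' ∈ countModule)
    (h : ∀ n, 2 ≤ n → g n = g' n) : g ∈ countModule := by
  have e0 : (Pi.single 0 1 : ℕ → ℤ) ∈ countModule :=
    Submodule.subset_span (by simp [generators])
  have e1 : (Pi.single 1 1 : ℕ → ℤ) ∈ countModule :=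
    Submodule.subset_span (by simp [generators])
  have : g = g' + ((g 0 - g' 0) • Pi.single 0 1 + (g 1 - g' 1) • Pi.single 1 1) := by
    funext n
    obtain rfl | rfl | hn : n = 0 ∨ n = 1 ∨ 2 ≤ n := by omega
    · simp
    · simp
    · simp [h n hn, show n ≠ 0 by omega, show n ≠ 1 by omega]
  rw [this]
  exact add_mem hg' (add_mem (Submodule.smul_mem _ _ e0) (Submodule.smul_mem _ _ e1))

theorem mem_countModule_of_eq_add {g : ℕ → ℤ} {g₁ g₂ : ℕ → ℕ}
    (h₁ : (fun n => (g₁ n : ℤ)) ∈ countModule) (h₂ : (fun n => (g₂ n : ℤ)) ∈ countModule)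
    (h : ∀ n, 2 ≤ n → g n = (g₁ n + g₂ n : ℕ)) : g ∈ countModule :=
  mem_countModule_of_eq (add_mem h₁ h₂) fun n hn => by simp [h n hn]

theorem f_mem : (fun n => (f n : ℤ)) ∈ countModule :=
  Submodule.subset_span (by simp [generators])

theorem complexity_mem : (fun n => (complexity n : ℤ)) ∈ countModule :=
  Submodule.subset_span (by simp [generators])

theorem complexity_add_one_mem : (fun n => (complexity (n + 1) : ℤ)) ∈ countModule :=
  Submodule.subset_span (by simp [generators])

theorem complexity_add_two_mem : (fun n => (complexity (n + 2) : ℤ)) ∈ countModule :=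
  Submodule.subset_span (by simp [generators])

theorem pairCount_mem (α : Fin 2) : (fun n => (pairCount n α : ℤ)) ∈ countModule :=
  Submodule.subset_span (Or.inl (Or.inr (Or.inl ⟨α, rfl⟩)))

theorem pairCount_add_one_mem (α : Fin 2) :
    (fun n => (pairCount (n + 1) α : ℤ)) ∈ countModule :=
  Submodule.subset_span (Or.inl (Or.inr (Or.inr ⟨α, rfl⟩)))

theorem tripleCount_mem (α β : Fin 2) :
    (fun n => (tripleCount n (2 * n) α β : ℤ)) ∈ countModule :=
  Submodule.subset_span (Or.inr (Or.inl (Or.inl (Or.inl ⟨(α, β), rfl⟩))))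

theorem tripleCount_succ_mem (α β : Fin 2) :
    (fun n => (tripleCount (n + 1) (2 * (n + 1)) α β : ℤ)) ∈ countModule :=
  Submodule.subset_span (Or.inr (Or.inl (Or.inl (Or.inr ⟨(α, β), rfl⟩))))

theorem tripleCount_left_mem (α β : Fin 2) :
    (fun n => (tripleCount n (2 * n + 1) α β : ℤ)) ∈ countModule :=
  Submodule.subset_span (Or.inr (Or.inl (Or.inr ⟨(α, β), rfl⟩)))

theorem tripleCount_right_mem (α β : Fin 2) :
    (fun n => (tripleCount (n + 1) (2 * n + 1) α β : ℤ)) ∈ countModule :=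
  Submodule.subset_span (Or.inr (Or.inr ⟨(α, β), rfl⟩))

/-- Precomposition with `φ` is linear, so stability need only be tested on generators. -/
theorem comp_mem_countModule {φ : ℕ → ℕ}
    (h : ∀ g ∈ generators, (fun n => g (φ n)) ∈ countModule) (g : ℕ → ℤ) (hg : g ∈ countModule) :
    (fun n => g (φ n)) ∈ countModule :=
  (Submodule.span_le (p := countModule.comap (LinearMap.funLeft ℤ ℤ φ))).2 h hg

theorem comp_two_mul_mem (g : ℕ → ℤ) (hg : g ∈ countModule) :
    (fun n => g (2 * n)) ∈ countModule := by
  refine comp_mem_countModule ?_ g hg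
  rintro g (((rfl | rfl | rfl | rfl | rfl | rfl) | ⟨α, rfl⟩ | ⟨α, rfl⟩) |
    ((⟨⟨α, β⟩, rfl⟩ | ⟨⟨α, β⟩, rfl⟩) | ⟨⟨α, β⟩, rfl⟩) | ⟨⟨α, β⟩, rfl⟩)
  · exact mem_countModule_of_eq (zero_mem _) fun n hn =>
      Pi.single_eq_of_ne (by omega) _
  · exact mem_countModule_of_eq (zero_mem _) fun n hn =>
      Pi.single_eq_of_ne (by omega) _
  · exact mem_countModule_of_eq_add (g₁ := fun n => complexity n + complexity (n + 1))
      (mem_countModule_of_eq_add complexity_mem complexity_add_one_mem fun _ _ => rfl)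
      (tripleCount_mem 0 0) fun n hn => congrArg _ (f_two_mul_eq hn)
  · exact mem_countModule_of_eq_add complexity_mem complexity_add_one_mem fun n hn =>
      congrArg _ (complexity_two_mul hn)
  · exact mem_countModule_of_eq_add complexity_add_one_mem complexity_add_one_mem fun n hn =>
      congrArg _ (complexity_two_mul_add_one hn)
  · exact mem_countModule_of_eq_add complexity_add_one_mem complexity_add_two_mem fun n hn =>
      congrArg _ (complexity_two_mul_add_two (by omega))
  · exact mem_countModule_of_eq_add (pairCount_mem _) (pairCount_mem _) fun n hn =>
      congrArg _ (pairCount_two_mul hn α)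
  · exact mem_countModule_of_eq_add (pairCount_mem _) (pairCount_add_one_mem _) fun n hn =>
      congrArg _ (pairCount_two_mul_add_one (by omega) α)
  · exact mem_countModule_of_eq_add (tripleCount_mem _ _) (tripleCount_mem _ _) fun n hn =>
      congrArg _ (tripleCount_two_mul (by omega) α β)
  · exact mem_countModule_of_eq_add (tripleCount_left_mem _ _) (tripleCount_right_mem _ _)
      fun n hn => congrArg _ (tripleCount_two_mul_add_one (by omega) α β)
  · exact mem_countModule_of_eq_add (tripleCount_mem _ _) (tripleCount_left_mem _ _)
      fun n hn => congrArg _ (tripleCount_left_two_mul (by omega) α β)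
  · exact mem_countModule_of_eq_add (tripleCount_mem _ _) (tripleCount_right_mem _ _)
      fun n hn => congrArg _ (tripleCount_right_two_mul (by omega) α β)

theorem comp_two_mul_add_one_mem (g : ℕ → ℤ) (hg : g ∈ countModule) :
    (fun n => g (2 * n + 1)) ∈ countModule := by
  refine comp_mem_countModule ?_ g hg
  rintro g (((rfl | rfl | rfl | rfl | rfl | rfl) | ⟨α, rfl⟩ | ⟨α, rfl⟩) |
    ((⟨⟨α, β⟩, rfl⟩ | ⟨⟨α, β⟩, rfl⟩) | ⟨⟨α, β⟩, rfl⟩) | ⟨⟨α, β⟩, rfl⟩)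
  · exact mem_countModule_of_eq (zero_mem _) fun n hn =>
      Pi.single_eq_of_ne (by omega) _
  · exact mem_countModule_of_eq (zero_mem _) fun n hn =>
      Pi.single_eq_of_ne (by omega) _
  · exact mem_countModule_of_eq_add (pairCount_mem 0) (pairCount_add_one_mem 0) fun n hn =>
      congrArg _ (f_two_mul_add_one_eq (by omega))
  · exact mem_countModule_of_eq_add complexity_add_one_mem complexity_add_one_mem fun n hn =>
      congrArg _ (complexity_two_mul_add_one hn)
  · exact mem_countModule_of_eq_add complexity_add_one_mem complexity_add_two_mem fun n hn =>
      congrArg _ (complexity_two_mul_add_two (by omega))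
  · exact mem_countModule_of_eq_add complexity_add_two_mem complexity_add_two_mem fun n hn =>
      congrArg _ (complexity_two_mul_add_three (by omega))
  · exact mem_countModule_of_eq_add (pairCount_mem _) (pairCount_add_one_mem _) fun n hn =>
      congrArg _ (pairCount_two_mul_add_one (by omega) α)
  · exact mem_countModule_of_eq_add (pairCount_add_one_mem _) (pairCount_add_one_mem _)
      fun n hn => congrArg _ (pairCount_two_mul_add_two (by omega) α)
  · exact mem_countModule_of_eq_add (tripleCount_left_mem _ _) (tripleCount_right_mem _ _)
      fun n hn => congrArg _ (tripleCount_two_mul_add_one (by omega) α β)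
  · exact mem_countModule_of_eq_add (tripleCount_succ_mem _ _) (tripleCount_succ_mem _ _)
      fun n hn => congrArg _ (tripleCount_two_mul_add_two (by omega) α β)
  · exact mem_countModule_of_eq_add (tripleCount_left_mem _ _) (tripleCount_succ_mem _ _)
      fun n hn => congrArg _ (tripleCount_left_two_mul_add_one (by omega) α β)
  · exact mem_countModule_of_eq_add (tripleCount_right_mem _ _) (tripleCount_succ_mem _ _)
      fun n hn => congrArg _ (tripleCount_right_two_mul_add_one (by omega) α β)

end ThueMorse

theorem mainTheorem4 :
    (∀ n : ℕ, (ThueMorse.f n : ℚ) =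
      ThueMorse.v ⬝ᵥ (((ThueMorse.binary n).map ThueMorse.M).prod *ᵥ ThueMorse.w)) ∧
    ThueMorse.IsRegular 2 (fun n => (ThueMorse.f n : ℤ)) := by
  refine ⟨fun n => ?_, ThueMorse.isRegular_two_of_mem
    (Submodule.fg_span ThueMorse.finite_generators) ThueMorse.f_mem ThueMorse.comp_two_mul_mem
    ThueMorse.comp_two_mul_add_one_mem⟩
  rw [Matrix.dotProduct_mulVec]
  exact ThueMorse.f_eq_coords_dotProduct n
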